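/- All rings are associative with identity, and modules are left modules unless said otherwise. For a ring $A$, an $A$-module $M$ is Gorenstein projective if $M\cong\ker(P^0\to P^1)$ for some exact complex $\mathbf P=(\cdots\to P^{-1}\to P^0\to P^1\to\cdots)$ of projective $A$-modules such that $\operatorname{Hom}_A(\mathbf P,Q)$ is exact for every projective $A$-module $Q$. The Gorenstein projective $A$-modules are precovering if every $A$-module $M$ admits a homomorphism $\varphi:X\to M$ with $X$ Gorenstein projective such that every homomorphism $f:X'\to M$ with $X'$ Gorenstein projective has the form $f=\varphi g$ for some $g:X'\to X$. A ring extension $S\subseteq R$ (with the same identity) is called excellent if (i) there are finitely many elements $b_1,\dots,b_n\in R$ with $Sb_j=b_jS$ for all $j$ that form a basis of $R$ both as a left and as a right $S$-module; and (ii) $R$ is $S$-projective: for every $R$-module $M$ and every $R$-submodule $N$ of $M$, if $N$ is a direct summand of $M$ as an $S$-module, then $N$ is a direct summand of $M$ as an $R$-module. **Corollary.** (1) Let $S\subseteq R$ be an excellent extension with $S$ commutative. If the Gorenstein projective $S$-modules are precovering, then the Gorenstein projective $R$-modules are precovering. (2) Let $S$ be a ring and $G$ a finite group acting on $S$ by ring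 automorphisms, such that $|G|$ is invertible in $S$. Then the skew group ring $S*G$ is an excellent extension of $S$. Consequently, if moreover $S$ is commutative and the Gorenstein projective $S$-modules are precovering, then the Gorenstein projective $S*G$-modules are precovering. -/

import Mathlib

open CategoryTheory

universe u v

/-- An object `M` of an abelian category is Gorenstein projective if there is an exact complex
`⋯ ⟶ P (-1) ⟶ P 0 ⟶ P 1 ⟶ ⋯` of projective objects with `M ≅ ker (P 0 ⟶ P 1)` which stays exact
under `Hom(-, Q)` for every projective object `Q`. -/
def IsGorensteinProjective {A : Type u} [Category.{v} A] [Abelian A] (M : A) : Prop :=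
  ∃ P : CochainComplex A ℤ,
    (∀ i, Projective (P.X i)) ∧
    P.Acyclic ∧
    -- exactness of `Hom(P (i+1), Q) ⟶ Hom(P i, Q) ⟶ Hom(P (i-1), Q)` at the middle term
    (∀ Q : A, Projective Q → ∀ (i : ℤ) (f : P.X i ⟶ Q), P.d (i - 1) i ≫ f = 0 →
      ∃ g : P.X (i + 1) ⟶ Q, P.d i (i + 1) ≫ g = f) ∧
    Nonempty (M ≅ Limits.kernel (P.d 0 1))

/-- `φ : L ⟶ M` is an `X`-precover of `M`. -/
def IsPrecover {A : Type u} [Category.{v} A] (X : A → Prop) {L M : A} (φ : L ⟶ M) : Prop :=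
  X L ∧ ∀ (L' : A) (f : L' ⟶ M), X L' → ∃ g : L' ⟶ L, g ≫ φ = f

/-- The class `X` is precovering: every object has an `X`-precover. -/
def IsPrecovering {A : Type u} [Category.{v} A] (X : A → Prop) : Prop :=
  ∀ M : A, ∃ (L : A) (φ : L ⟶ M), IsPrecover X φ

/-- The Gorenstein projective left `R`-modules are precovering in the category of all left
`R`-modules. -/
def GorensteinProjectivesArePrecovering (R : Type u) [Ring R] : Prop :=
  IsPrecovering (fun M : ModuleCat.{u} R => IsGorensteinProjective M)

/-- For an extension of rings `i : S →+* R`: whenever an `R`-submodule `N` of a left `R`-module `M`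
is a direct summand of `M` as an `S`-module, it is a direct summand of `M` as an `R`-module. -/
def IsRelativelyProjective {S R : Type u} [Ring S] [Ring R] (i : S →+* R) : Prop :=
  ∀ (M : Type u) [AddCommGroup M] [Module R M] (N : Submodule R M),
    -- `C` is an `S`-submodule of `M` complementary to `N`
    (∃ C : AddSubgroup M, (∀ (s : S), ∀ c ∈ C, i s • c ∈ C) ∧ IsCompl N.toAddSubgroup C) →
    ∃ C : Submodule R M, IsCompl N C

/-- `S ⊆ R`, the inclusion being `i`, is an excellent extension: `R` has a finite family of elements
`b j` with `S b j = b j S` that is a basis of `R` both as a left and as a right `S`-module, and `R`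
is `S`-projective in the sense of `IsRelativelyProjective`. -/
structure IsExcellentExtension {S R : Type u} [Ring S] [Ring R] (i : S →+* R) : Prop where
  injective : Function.Injective i
  exists_basis : ∃ (n : ℕ) (b : Fin n → R),
    (∀ j, Set.range (fun s : S => i s * b j) = Set.range (fun s : S => b j * i s)) ∧
    (∀ r : R, ∃! c : Fin n → S, r = ∑ j, i (c j) * b j) ∧
    (∀ r : R, ∃! c : Fin n → S, r = ∑ j, b j * i (c j))
  relativelyProjective : IsRelativelyProjective i

/-! Restriction `U` from `R` to `S` has a left adjoint `F = R ⊗[S] -` and a right adjoint `H =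
Hom_S(R, -)`. Freeness of `R` on the right makes `F` exact, and freeness on the left makes `U`
preserve projectives. `H` preserves projectives because `Hom_S(R, Q)` is, over `S`, a finite product
of twists of `Q` by automorphisms, and relative projectivity lifts projectivity from `S` to `R`.
Hence `F` and `U` both preserve Gorenstein projectives (`IsGorensteinProjective.map_of_adjunction`).
The counit `F U N ⟶ N` splits over `S`, hence over `R`, so the transpose of a precover of `U N` is a
precover of `N` (`IsPrecovering.of_adjunction`). For the skew group ring, the group elements form
the basis, and Maschke averaging gives relative projectivity. -/

/-! ### Gorenstein projectives and precovers under adjunctions. -/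

section Categorical

variable {A B : Type*} [Category* A] [Category* B]

/-- An exact left adjoint preserves Gorenstein projective objects if it and its right adjoint
preserve projective objects. -/
theorem IsGorensteinProjective.map_of_adjunction [Abelian A] [Abelian B] {F : A ⥤ B} {G : B ⥤ A}
    (adj : F ⊣ G) [F.Additive] [Limits.PreservesFiniteLimits F] [F.PreservesProjectiveObjects]
    [G.PreservesProjectiveObjects] {M : A} (hM : IsGorensteinProjective M) :
    IsGorensteinProjective (F.obj M) := by
  obtain ⟨P, hP, hacyc, hHom, ⟨e⟩⟩ := hM
  have := adj.leftAdjoint_preservesColimits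
  refine ⟨(F.mapHomologicalComplex _).obj P, fun i => F.projective_obj_of_projective (hP i),
    fun i => (hacyc i).map F, fun Q hQ i (f : F.obj (P.X i) ⟶ Q) hf => ?_,
    ⟨F.mapIso e ≪≫ Limits.PreservesKernel.iso F _⟩⟩
  change F.map (P.d (i - 1) i) ≫ f = 0 at hf
  change ∃ g : F.obj (P.X (i + 1)) ⟶ Q, F.map (P.d i (i + 1)) ≫ g = f
  -- The transpose of `f` lands in the projective object `G.obj Q`, so it extends along the
  -- differential of `P`.
  obtain ⟨g, hg⟩ := hHom (G.obj Q) (G.projective_obj_of_projective hQ) i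
    (adj.homEquiv _ _ f) (by
      have := adj.right_adjoint_additive
      rw [← adj.homEquiv_naturality_left, hf, adj.homEquiv_unit, G.map_zero, Limits.comp_zero])
  refine ⟨(adj.homEquiv _ _).symm g, ?_⟩
  rw [← adj.homEquiv_naturality_left_symm, hg, Equiv.symm_apply_apply]

/-- Precovers transfer along a left adjoint if the counit of the adjunction is a split epimorphism
and both functors respect the classes in question. -/
theorem IsPrecovering.of_adjunction {X : A → Prop} {Y : B → Prop} {F : A ⥤ B} {G : B ⥤ A}
    (adj : F ⊣ G) (hF : ∀ M, X M → Y (F.obj M)) (hG : ∀ N, Y N → X (G.obj N))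
    (hsplit : ∀ N, IsSplitEpi (adj.counit.app N)) (hX : IsPrecovering X) : IsPrecovering Y := by
  intro N
  obtain ⟨L, φ, hL, hφ⟩ := hX (G.obj N)
  refine ⟨F.obj L, (adj.homEquiv _ _).symm φ, hF _ hL, fun N' f hN' => ?_⟩
  obtain ⟨g, hg⟩ := hφ _ (G.map f) (hG _ hN')
  have := hsplit N'
  -- `F.map g` only lifts `f` precomposed with the counit at `N'`; the section removes the counit.
  refine ⟨section_ (adj.counit.app N') ≫ F.map g, ?_⟩
  rw [Category.assoc, ← adj.homEquiv_naturality_left_symm, hg, Adjunction.homEquiv_counit,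
    adj.counit_naturality, IsSplitEpi.id_assoc]

end Categorical

/-! ### Lifting splittings from `S` to `R`. -/

section RelativelyProjective

variable {S R : Type u} [Ring S] [Ring R] {i : S →+* R}

/-- The range of `s` is an `S`-complement of `ker φ`. Any `R`-complement `C` is then mapped
isomorphically onto `N` by `φ`, and the inverse is the section. -/
theorem IsRelativelyProjective.exists_rightInverse (hi : IsRelativelyProjective i)
    {M N : Type u} [AddCommGroup M] [Module R M] [AddCommGroup N] [Module R N] (φ : M →ₗ[R] N)
    (s : N →+ M) (hs : ∀ n, φ (s n) = n) (hsmul : ∀ (t : S) (n : N), s (i t • n) = i t • s n) :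
    ∃ ψ : N →ₗ[R] M, ∀ n, φ (ψ n) = n := by
  obtain ⟨C, hC⟩ := hi M (LinearMap.ker φ) ⟨s.range, by
    rintro t _ ⟨n, rfl⟩
    exact ⟨i t • n, hsmul t n⟩, by
    rw [disjoint_iff_inf_le]
    rintro _ ⟨hx, n, rfl⟩
    have : φ (s n) = 0 := hx
    rw [hs] at this
    simp [this], by
    rw [codisjoint_iff_le_sup]
    intro m _
    rw [← sub_add_cancel m (s (φ m))]
    refine add_mem (AddSubgroup.mem_sup_left ?_) (AddSubgroup.mem_sup_right ⟨φ m, rfl⟩)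
    simp [hs]⟩
  have hbij : Function.Bijective (φ.domRestrict C) := by
    refine ⟨(injective_iff_map_eq_zero _).2 fun c hc => Subtype.ext ?_, fun n => ?_⟩
    · exact Submodule.disjoint_def.1 hC.disjoint c hc c.2
    · obtain ⟨k, c, hkc⟩ := Submodule.mem_sup'.1
        (show s n ∈ LinearMap.ker φ ⊔ C by rw [hC.sup_eq_top]; trivial)
      refine ⟨c, ?_⟩
      have := congr(φ $hkc)
      rwa [hs, map_add, LinearMap.mem_ker.1 k.2, zero_add] at this
  let e := LinearEquiv.ofBijective _ hbij
  exact ⟨C.subtype ∘ₗ e.symm.toLinearMap, e.apply_symm_apply⟩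

theorem IsRelativelyProjective.isSplitEpi (hi : IsRelativelyProjective i) {M N : ModuleCat.{u} R}
    (φ : M ⟶ N) [IsSplitEpi ((ModuleCat.restrictScalars i).map φ)] : IsSplitEpi φ := by
  let s := section_ ((ModuleCat.restrictScalars i).map φ)
  have hs (n : N) : φ.hom (s.hom n) = n :=
    congr($(IsSplitEpi.id ((ModuleCat.restrictScalars i).map φ)).hom n)
  obtain ⟨ψ, hψ⟩ := hi.exists_rightInverse φ.hom s.hom.toAddMonoidHom hs
    fun t (n : N) => s.hom.map_smul t n
  exact ⟨⟨⟨ModuleCat.ofHom ψ, by ext n; exact hψ n⟩⟩⟩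

theorem IsRelativelyProjective.projective_of_restrictScalars (hi : IsRelativelyProjective i)
    {P : ModuleCat.{u} R} (hP : Projective ((ModuleCat.restrictScalars i).obj P)) :
    Projective P := by
  have : IsSplitEpi ((ModuleCat.restrictScalars i).map (Projective.π P)) :=
    ⟨⟨⟨Projective.factorThru (𝟙 _) _, Projective.factorThru_comp _ _⟩⟩⟩
  have := hi.isSplitEpi (Projective.π P)
  exact Retract.projective ⟨section_ (Projective.π P), Projective.π P, IsSplitEpi.id _⟩

end RelativelyProjective

/-! ### Bases of `R` over `S` and the automorphisms they induce. -/

section Basis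

variable {S R : Type u} [Ring S] [Ring R] {i : S →+* R} {ι : Type*} [Fintype ι] {b : ι → R}

theorem injective_mul_of_existsUnique_sum (hb : ∀ r : R, ∃! c : ι → S, r = ∑ j, i (c j) * b j)
    (j : ι) : Function.Injective fun s : S => i s * b j := by
  classical
  intro s t hst
  have h (s : S) : i s * b j = ∑ k, i ((Pi.single j s : ι → S) k) * b k := by
    rw [Finset.sum_eq_single j] <;> simp +contextual
  simpa using congr_fun ((hb (i s * b j)).unique (h s) (hst.trans (h t))) j

theorem mul_injective_of_existsUnique_sum (hb : ∀ r : R, ∃! c : ι → S, r = ∑ j, b j * i (c j))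
    (j : ι) : Function.Injective fun s : S => b j * i s := by
  classical
  intro s t hst
  have h (s : S) : b j * i s = ∑ k, b k * i ((Pi.single j s : ι → S) k) := by
    rw [Finset.sum_eq_single j] <;> simp +contextual
  simpa using congr_fun ((hb (b j * i s)).unique (h s) (hst.trans (h t))) j

/-- An element `x` with `S x = x S` that is free on both sides induces an automorphism of `S`. -/
theorem exists_ringEquiv_of_range_mul_eq {x : R}
    (hx : Set.range (fun s : S => i s * x) = Set.range (fun s : S => x * i s))
    (hl : Function.Injective fun s : S => i s * x) (hr : Function.Injective fun s : S => x * i s) :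
    ∃ σ : S ≃+* S, ∀ s, x * i s = i (σ s) * x := by
  have h (s : S) : ∃ t, i t * x = x * i s := by
    rw [← Set.mem_range (f := fun s : S => i s * x), hx]
    exact Set.mem_range_self s
  choose f hf using h
  -- Each ring identity for `f` is checked after right multiplication by `x`, which `hl` allows to
  -- cancel.
  let σ : S →+* S :=
    { toFun := f
      map_one' := hl (by simp [hf])
      map_zero' := hl (by simp [hf])
      map_add' s t := hl (by simp [hf, add_mul, mul_add])
      map_mul' s t := hl (by
        simp only [hf, map_mul, mul_assoc]; rw [← mul_assoc x, ← hf, mul_assoc]) }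
  have hσ (s : S) : i (σ s) * x = x * i s := hf s
  refine ⟨RingEquiv.ofBijective σ ⟨fun s t hst => hr ?_, fun t => ?_⟩, fun s => (hσ s).symm⟩
  · simp [← hσ, hst]
  · obtain ⟨s, hs⟩ : i t * x ∈ Set.range (fun s : S => x * i s) := hx ▸ Set.mem_range_self t
    exact ⟨s, hl ((hσ s).trans hs)⟩

/-- The basis of `R` as a left `S`-module given by unique left coordinates. -/
noncomputable def restrictScalarsBasis (hb : ∀ r : R, ∃! c : ι → S, r = ∑ j, i (c j) * b j) :
    Module.Basis ι S ((ModuleCat.restrictScalars i).obj (ModuleCat.of R R)) :=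
  .ofEquivFun (LinearEquiv.ofBijective
    (Fintype.linearCombination S (M := (ModuleCat.restrictScalars i).obj (ModuleCat.of R R)) b)
    ⟨fun _ _ h => (hb _).unique rfl h, fun r => (hb r).exists.imp fun _ h => h.symm⟩).symm

theorem restrictScalarsBasis_apply (hb : ∀ r : R, ∃! c : ι → S, r = ∑ j, i (c j) * b j) (j : ι) :
    restrictScalarsBasis hb j = b j := by
  classical
  have := Fintype.linearCombination_apply_single S
    (M := (ModuleCat.restrictScalars i).obj (ModuleCat.of R R)) (v := b) (i := j) 1
  rw [restrictScalarsBasis, Module.Basis.coe_ofEquivFun]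
  exact this.trans (one_smul S
    (show (ModuleCat.restrictScalars i).obj (ModuleCat.of R R) from b j))

end Basis

/-! ### Restriction and coextension preserve projectives. -/

section Restriction

variable {S R : Type u} [Ring S] [Ring R] {i : S →+* R} {ι : Type*} [Fintype ι] {b : ι → R}

/-- The right adjoint `Hom_S(R, -)` preserves epimorphisms when `R` is projective over `S`. -/
theorem ModuleCat.restrictScalars_preservesProjectiveObjects
    [Module.Projective S ((ModuleCat.restrictScalars i).obj (ModuleCat.of R R))] :
    (ModuleCat.restrictScalars.{u} i).PreservesProjectiveObjects := by
  have : (ModuleCat.coextendScalars.{u, u, u} i).PreservesEpimorphisms := ⟨fun {M N} g hg => by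
    rw [ModuleCat.epi_iff_surjective] at hg ⊢
    intro (f : (ModuleCat.restrictScalars i).obj (ModuleCat.of R R) →ₗ[S] N)
    exact Module.projective_lifting_property g.hom f hg⟩
  exact Functor.preservesProjectiveObjects_of_adjunction_of_preservesEpimorphisms
    (ModuleCat.restrictCoextendScalarsAdj i)

theorem IsExcellentExtension.coextendScalars_preservesProjectiveObjects
    (hi : IsExcellentExtension i) :
    (ModuleCat.coextendScalars.{u, u, u} i).PreservesProjectiveObjects where
  projective_obj {Q} hQ := by
    obtain ⟨n, b, hb, hl, hr⟩ := hi.exists_basis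
    choose σ hσ using fun j => exists_ringEquiv_of_range_mul_eq (hb j)
      (injective_mul_of_existsUnique_sum hl j) (mul_injective_of_existsUnique_sum hr j)
    refine hi.relativelyProjective.projective_of_restrictScalars ?_
    -- Evaluation at `b j` is `S`-linear only into the twist of `Q` by `σ j`: `(s • f) (b j) = f (b
    -- j * i s) = σ j s • f (b j)`.
    let T (j : Fin n) : ModuleCat.{u} S := (ModuleCat.restrictScalars (σ j).toRingHom).obj Q
    have hT (j : Fin n) : Projective (T j) :=
      (ModuleCat.restrictScalarsEquivalenceOfRingEquiv (σ j)).functor.projective_obj_of_projective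
        hQ
    have hT' (j : Fin n) : Module.Projective S (T j) := (IsProjective.iff_projective _).2 (hT j)
    let Φ : (ModuleCat.restrictScalars i).obj ((ModuleCat.coextendScalars i).obj Q) →ₗ[S]
        ∀ j, T j :=
      { toFun f j := (show (ModuleCat.restrictScalars i).obj (ModuleCat.of R R) →ₗ[S] Q from f)
          (b j)
        map_add' f g := rfl
        map_smul' s f := by
          ext j
          let f' : (ModuleCat.restrictScalars i).obj (ModuleCat.of R R) →ₗ[S] Q := f
          change f' (b j * i s) = σ j s • f' (b j)
          rw [hσ]
          exact f'.map_smul (σ j s) (b j) }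
    have hΦ : Function.Bijective Φ := by
      refine ⟨fun f g hfg => ?_, fun q => ?_⟩
      · refine (restrictScalarsBasis hl).ext (f₁ := f) (f₂ := g) fun j => ?_
        rw [restrictScalarsBasis_apply]
        exact congr_fun hfg j
      · refine ⟨(restrictScalarsBasis hl).constr ℕ (M' := Q) q, funext fun j => ?_⟩
        have := (restrictScalarsBasis hl).constr_basis ℕ (M' := Q) q j
        rwa [restrictScalarsBasis_apply] at this
    have : Module.Projective S (∀ j, T j) :=
      .of_equiv (DFinsupp.linearEquivFunOnFintype (R := S) (M := fun j => T j))
    have := Module.Projective.of_equiv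
      (N := (ModuleCat.restrictScalars i).obj ((ModuleCat.coextendScalars i).obj Q))
      (LinearEquiv.ofBijective Φ hΦ).symm
    exact (IsProjective.iff_projective
      ((ModuleCat.restrictScalars i).obj ((ModuleCat.coextendScalars i).obj Q))).1 this

end Restriction

/-! ### Extension of scalars and its exactness. -/

section Extension

open TensorProduct

/-- The ring `R` as an `(R, S)`-bimodule, for a homomorphism `i : S →+* R` from a commutative ring:
`S` acts by right multiplication. -/
def RightRestriction {S R : Type u} [CommRing S] [Ring R] (_ : S →+* R) : Type u := R

namespace RightRestriction

variable {S R : Type u} [CommRing S] [Ring R] (i : S →+* R)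

instance : AddCommGroup (RightRestriction i) := inferInstanceAs (AddCommGroup R)

instance : Module R (RightRestriction i) := inferInstanceAs (Module R R)

instance : Module S (RightRestriction i) where
  smul s r := (show R from r) * i s
  one_smul r := (congrArg (fun x : R => (show R from r) * x) i.map_one).trans (mul_one (M := R) r)
  -- Commutativity of `S` turns the right action into a left one.
  mul_smul s t r := show (show R from r) * i (s * t) = (show R from r) * i t * i s by
    rw [mul_comm s, map_mul, mul_assoc]
  smul_zero s := zero_mul (M₀ := R) (i s)
  zero_smul r := show (show R from r) * i 0 = (0 : R) by rw [map_zero, mul_zero]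
  smul_add s r t := add_mul (R := R) r t (i s)
  add_smul s t r := show (show R from r) * i (s + t) = (show R from r) * i s + (show R from r) * i t
    by rw [map_add, mul_add]

instance : SMulCommClass R S (RightRestriction i) :=
  ⟨fun r s x => (mul_assoc (G := R) r x (i s)).symm⟩

instance : SMulCommClass S R (RightRestriction i) := .symm _ _ _

theorem free {ι : Type*} [Fintype ι] {b : ι → R}
    (hb : ∀ r : R, ∃! c : ι → S, r = ∑ j, b j * i (c j)) : Module.Free S (RightRestriction i) :=
  .of_equiv (LinearEquiv.ofBijective (Fintype.linearCombination S (M := RightRestriction i) b)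
    ⟨fun _ _ h => (hb _).unique rfl h, fun r => (hb r).exists.imp fun _ h => h.symm⟩)

/-- The element `1` of `R`. -/
def one : RightRestriction i := (1 : R)

theorem smul_one_eq (s : S) : s • one i = i s • one i :=
  (one_mul (M := R) (i s)).trans (mul_one (M := R) (i s)).symm

/-- The biadditive map `(r, x) ↦ r • g x`. -/
noncomputable def fromAddHom {X : ModuleCat.{u} S} {Y : ModuleCat.{u} R}
    (g : X ⟶ (ModuleCat.restrictScalars i).obj Y) : RightRestriction i →+ X →+ Y :=
  AddMonoidHom.mk' (fun r => (smulAddHom R Y (show R from r)).comp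
    (show X →+ Y from g.hom.toAddMonoidHom)) fun r s => by
      ext x; exact add_smul (show R from r) (show R from s) (show Y from g.hom x)

theorem fromAddHom_smul {X : ModuleCat.{u} S} {Y : ModuleCat.{u} R}
    (g : X ⟶ (ModuleCat.restrictScalars i).obj Y) (s : S) (r : RightRestriction i) (x : X) :
    fromAddHom i g (s • r) x = fromAddHom i g r (s • x) := by
  change ((show R from r) * i s) • (show Y from g.hom x) =
    (show R from r) • (show Y from g.hom (s • x))
  rw [mul_smul, g.hom.map_smul]
  rfl

/-- The `S`-linear map `x ↦ f (1 ⊗ x)`. -/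
noncomputable def toRestriction {X : ModuleCat.{u} S} {Y : ModuleCat.{u} R}
    (f : ModuleCat.of R (RightRestriction i ⊗[S] X) ⟶ Y) :
    X ⟶ (ModuleCat.restrictScalars i).obj Y :=
  ModuleCat.ofHom (Y := (ModuleCat.restrictScalars i).obj Y)
    { toFun x := f.hom (one i ⊗ₜ x)
      map_add' x y := by rw [tmul_add, map_add]; rfl
      map_smul' s x := by
        rw [← smul_tmul, smul_one_eq, ← smul_tmul', map_smul]; rfl }

/-- The tensor-hom bijection for the extension of scalars along `i`. -/
noncomputable def homEquiv (X : ModuleCat.{u} S) (Y : ModuleCat.{u} R) :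
    (ModuleCat.of R (RightRestriction i ⊗[S] X) ⟶ Y) ≃
      (X ⟶ (ModuleCat.restrictScalars i).obj Y) where
  toFun := toRestriction i
  invFun g := ModuleCat.ofHom
    { toAddHom := (TensorProduct.liftAddHom (fromAddHom i g) (fromAddHom_smul i g)).toAddHom
      map_smul' r x := by
        change TensorProduct.liftAddHom (fromAddHom i g) (fromAddHom_smul i g) (r • x) =
          r • TensorProduct.liftAddHom (fromAddHom i g) (fromAddHom_smul i g) x
        induction x with
        | zero => simp
        | tmul t x => exact mul_smul r (show R from t) (show Y from g.hom x)
        | add x y hx hy => simp only [smul_add, map_add, hx, hy] }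
  left_inv f := by
    ext (x : RightRestriction i ⊗[S] X)
    change TensorProduct.liftAddHom (fromAddHom i (toRestriction i f)) (fromAddHom_smul i _) x =
      f.hom x
    induction x with
    | zero => simp
    | tmul t x =>
      refine (map_smul f.hom (show R from t) (one i ⊗ₜ[S] x)).symm.trans (congrArg f.hom ?_)
      rw [smul_tmul']
      exact congrArg (· ⊗ₜ[S] x) (mul_one (M := R) t)
    | add x y hx hy => rw [map_add, map_add, hx, hy]
  right_inv g := by
    ext x
    exact one_smul R (show Y from g.hom x)

end RightRestriction

open RightRestriction

variable {S R : Type u} [CommRing S] [Ring R] (i : S →+* R)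

/-- Extension of scalars from a commutative ring to a noncommutative one. -/
noncomputable def inducedModuleFunctor : ModuleCat.{u} S ⥤ ModuleCat.{u} R :=
  Adjunction.leftAdjointOfEquiv (G := ModuleCat.restrictScalars i) (homEquiv i) fun _ _ _ _ _ => rfl

/-- Extension of scalars is left adjoint to restriction of scalars. -/
noncomputable def inducedModuleAdj : inducedModuleFunctor i ⊣ ModuleCat.restrictScalars.{u} i :=
  Adjunction.adjunctionOfEquivLeft (G := ModuleCat.restrictScalars i) (homEquiv i)
    fun _ _ _ _ _ => rfl

/-- Identifies the functor built from the adjunction with tensoring on maps, so that flatness can be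
applied. -/
theorem inducedModuleFunctor_map_apply {X Y : ModuleCat.{u} S} (f : X ⟶ Y)
    (x : RightRestriction i ⊗[S] X) :
    ((inducedModuleFunctor i).map f).hom x = f.hom.lTensor (RightRestriction i) x := by
  change (((homEquiv i) X _).symm (f ≫ homEquiv i Y _ (𝟙 _))).hom x = _
  induction x with
  | zero => rw [map_zero, map_zero]
  | tmul t x =>
    change (show R from t) • (one i ⊗ₜ[S] f.hom x) = t ⊗ₜ f.hom x
    rw [smul_tmul']
    exact congrArg (· ⊗ₜ[S] f.hom x) (mul_one (M := R) t)
  | add x y hx hy => rw [map_add, map_add, hx, hy]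

instance : (inducedModuleFunctor i).Additive := (inducedModuleAdj i).left_adjoint_additive

instance : (inducedModuleFunctor i).PreservesProjectiveObjects :=
  Functor.preservesProjectiveObjects_of_adjunction_of_preservesEpimorphisms (inducedModuleAdj i)

/-- Right exactness is automatic for a left adjoint; flatness supplies preservation of
monomorphisms. -/
theorem inducedModuleFunctor_preservesFiniteLimits [Module.Flat S (RightRestriction i)] :
    Limits.PreservesFiniteLimits (inducedModuleFunctor i) := by
  have := (inducedModuleAdj i).leftAdjoint_preservesColimits
  refine ((inducedModuleFunctor i).preservesFiniteLimits_iff_forall_exact_map_and_mono).2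
    fun T hT => ⟨?_, ?_⟩
  · have := hT.epi_g
    exact hT.exact.map_of_epi_of_preservesCokernel _ hT.epi_g inferInstance
  · have := hT.mono_f
    rw [ModuleCat.mono_iff_injective] at this ⊢
    intro x y hxy
    exact Module.Flat.lTensor_preserves_injective_linearMap T.f.hom this
      ((inducedModuleFunctor_map_apply i T.f x).symm.trans
        (hxy.trans (inducedModuleFunctor_map_apply i T.f y)))

end Extension

/-! ### The skew group ring is an excellent extension. -/

section SkewGroupRing

open SkewMonoidAlgebra

theorem SkewMonoidAlgebra.sum_single_eq_iff {S G : Type*} [Ring S] [Fintype G]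
    (r : SkewMonoidAlgebra S G) (c : G → S) : r = ∑ g, single g (c g) ↔ c = r.coeff := by
  classical
  have h (x : G) : (∑ g, single g (c g)).coeff x = c x := by
    have := congr($(_root_.map_sum (coeffAddEquiv (k := S) (G := G)) (fun g => single g (c g))
      Finset.univ) x)
    rw [Finsupp.finsetSum_apply] at this
    refine this.trans ?_
    rw [Finset.sum_eq_single x]
    · exact Finsupp.single_eq_same
    · intro y _ hy
      exact Finsupp.single_eq_of_ne hy.symm
    · simp
  rw [SkewMonoidAlgebra.ext_iff, funext_iff]
  simp [h, eq_comm]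

/-- The permutations `φ j` cover both sides at once: left coordinates are untwisted, right ones are
twisted by the action of `e j`. -/
theorem SkewMonoidAlgebra.existsUnique_sum_single {S G ι : Type*} [Ring S] [Fintype ι] (e : ι ≃ G)
    (φ : ι → S ≃ S) (r : SkewMonoidAlgebra S G) :
    ∃! c : ι → S, r = ∑ j, single (e j) (φ j (c j)) := by
  have := Fintype.ofEquiv ι e
  have h (c : ι → S) : r = ∑ j, single (e j) (φ j (c j)) ↔
      c = fun j => (φ j).symm (r.coeff (e j)) := by
    have := sum_single_eq_iff r fun g => φ (e.symm g) (c (e.symm g))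
    rw [← e.sum_comp] at this
    simp only [Equiv.symm_apply_apply] at this
    rw [this, funext_iff, funext_iff, ← e.forall_congr_right]
    simp [Equiv.eq_symm_apply]
  simp only [h]
  exact existsUnique_eq

variable {S G : Type u} [Ring S] [Group G] [MulSemiringAction G S]

theorem SkewMonoidAlgebra.singleOneRingHom_mul_single_one (s : S) (g : G) :
    (singleOneRingHom s : SkewMonoidAlgebra S G) * single g 1 = single g s := by
  change single 1 s * single g 1 = _
  simp

theorem SkewMonoidAlgebra.single_one_mul_singleOneRingHom (s : S) (g : G) :
    single g 1 * (singleOneRingHom s : SkewMonoidAlgebra S G) = single g (g • s) := by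
  change single g 1 * single 1 s = _
  simp

theorem SkewMonoidAlgebra.singleOneRingHom_mul_single_one_comm (s : S) (g : G) :
    (singleOneRingHom s : SkewMonoidAlgebra S G) * single g 1 =
      single g 1 * singleOneRingHom (g⁻¹ • s) := by
  rw [singleOneRingHom_mul_single_one, single_one_mul_singleOneRingHom, smul_inv_smul]

/-- An additive projection onto an `S * G`-submodule that commutes with `S` can be averaged over
`G`. -/
theorem SkewMonoidAlgebra.exists_isProj_of_addMonoidHom [Finite G] (hG : IsUnit (Nat.card G : S))
    {M : Type*} [AddCommGroup M] [Module (SkewMonoidAlgebra S G) M]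
    (N : Submodule (SkewMonoidAlgebra S G) M) (p : M →+ M) (hpN : ∀ m, p m ∈ N)
    (hp : ∀ m ∈ N, p m = m)
    (hpS : ∀ (s : S) (m : M), p ((singleOneRingHom s : SkewMonoidAlgebra S G) • m) =
      (singleOneRingHom s : SkewMonoidAlgebra S G) • p m) :
    ∃ q : M →ₗ[SkewMonoidAlgebra S G] M, LinearMap.IsProj N q := by
  have := Fintype.ofFinite G
  let u (g : G) : SkewMonoidAlgebra S G := single g 1
  have hu (g h : G) : u g * u h = u (g * h) := by simp [u]
  have hu1 : u 1 = 1 := rfl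
  -- The unnormalised average, the sum of the conjugates of `p` by group elements.
  let A : M →+ M := ∑ g : G, (DistribSMul.toAddMonoidHom M (u g)).comp
    (p.comp (DistribSMul.toAddMonoidHom M (u g⁻¹)))
  have hA (m : M) : A m = ∑ g : G, u g • p (u g⁻¹ • m) := by
    simp [A]
  have hAu (h : G) (m : M) : A (u h • m) = u h • A m := by
    rw [hA, hA, Finset.smul_sum, ←
      Equiv.sum_comp (Equiv.mulLeft h) fun g => u g • p (u g⁻¹ • u h • m)]
    refine Finset.sum_congr rfl fun g _ => ?_
    simp [smul_smul, hu]
  have hAS (s : S) (m : M) : A ((singleOneRingHom s : SkewMonoidAlgebra S G) • m) =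
      (singleOneRingHom s : SkewMonoidAlgebra S G) • A m := by
    rw [hA, hA, Finset.smul_sum]
    refine Finset.sum_congr rfl fun g _ => ?_
    rw [smul_smul, smul_smul, singleOneRingHom_mul_single_one_comm]
    -- Passing `s` through `u g⁻¹` twists it by `g⁻¹`, matching the twist that arises from moving
    -- `s` past `u g` on the other side.
    have : u g⁻¹ * singleOneRingHom s = singleOneRingHom (g⁻¹ • s) * u g⁻¹ := by
      rw [singleOneRingHom_mul_single_one_comm, inv_inv, smul_inv_smul]
    rw [this, mul_smul, hpS, mul_smul]
  have hAr (r : SkewMonoidAlgebra S G) (m : M) : A (r • m) = r • A m := by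
    induction r using SkewMonoidAlgebra.induction_on with
    | zero => simp
    | single g s => rw [← singleOneRingHom_mul_single_one, mul_smul, hAS, hAu, mul_smul]
    | add f g hf hg => rw [add_smul, add_smul, map_add, hf, hg]
  obtain ⟨v, hv⟩ := hG.map (singleOneRingHom : S →+* SkewMonoidAlgebra S G)
  rw [map_natCast] at hv
  -- The order of `G` is a central unit, so dividing by it keeps the map linear.
  have hcomm (r : SkewMonoidAlgebra S G) : Commute (↑v⁻¹) r :=
    Commute.units_inv_left (hv ▸ Nat.cast_commute _ r)
  refine ⟨{ toFun m := (↑v⁻¹ : SkewMonoidAlgebra S G) • A m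
            map_add' x y := by rw [map_add, smul_add]
            map_smul' r m := by
              rw [hAr, smul_smul, (hcomm r).eq, mul_smul]; rfl }, fun m => ?_, fun m hm => ?_⟩
  · change (↑v⁻¹ : SkewMonoidAlgebra S G) • A m ∈ N
    rw [hA]
    exact N.smul_mem _ (sum_mem fun g _ => N.smul_mem _ (hpN _))
  · change (↑v⁻¹ : SkewMonoidAlgebra S G) • A m = m
    have : A m = (v : SkewMonoidAlgebra S G) • m := by
      rw [hA, Finset.sum_congr rfl fun g _ => by
        rw [hp _ (N.smul_mem _ hm), smul_smul, hu, mul_inv_cancel, hu1, one_smul]]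
      simp [hv, Nat.cast_smul_eq_nsmul]
    rw [this, smul_smul, Units.inv_mul, one_smul]

/-- The projection onto `N` along `C` is averaged; the kernel of the result is the required
complement. -/
theorem SkewMonoidAlgebra.isRelativelyProjective_singleOneRingHom [Finite G]
    (hG : IsUnit (Nat.card G : S)) :
    IsRelativelyProjective (singleOneRingHom : S →+* SkewMonoidAlgebra S G) := by
  intro M _ _ N ⟨C, hCS, hC⟩
  let _ : Module S M := Module.compHom M (singleOneRingHom : S →+* SkewMonoidAlgebra S G)
  let N' : Submodule S M := { N.toAddSubgroup with smul_mem' := fun s _ hx => N.smul_mem _ hx }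
  let C' : Submodule S M := { C with smul_mem' := hCS }
  have hNC : IsCompl N' C' := by
    refine ⟨Submodule.disjoint_def.2 fun x hx hx' => ?_, codisjoint_iff_le_sup.2 fun x _ => ?_⟩
    · exact AddSubgroup.disjoint_def.1 hC.disjoint hx hx'
    · obtain ⟨y, hy, z, hz, rfl⟩ := AddSubgroup.mem_sup.1
        (show x ∈ N.toAddSubgroup ⊔ C by rw [hC.sup_eq_top]; trivial)
      exact Submodule.add_mem_sup hy hz
  obtain ⟨q, hq⟩ := exists_isProj_of_addMonoidHom hG N (N'.projection C' hNC).toAddMonoidHom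
    (Submodule.projection_apply_mem hNC) (fun m hm => Submodule.projection_apply_of_mem_left hNC hm)
    (map_smul (N'.projection C' hNC))
  exact ⟨_, hq.isCompl⟩

theorem SkewMonoidAlgebra.isExcellentExtension_singleOneRingHom [Finite G]
    (hG : IsUnit (Nat.card G : S)) :
    IsExcellentExtension (singleOneRingHom : S →+* SkewMonoidAlgebra S G) where
  injective := single_injective 1
  exists_basis := by
    have := Fintype.ofFinite G
    let e := (Fintype.equivFin G).symm
    refine ⟨Fintype.card G, fun j => single (e j) 1, fun j => ?_, fun r => ?_, fun r => ?_⟩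
    · simp only [singleOneRingHom_mul_single_one, single_one_mul_singleOneRingHom]
      exact ((MulAction.surjective (e j)).range_comp (single (k := S) (e j))).symm
    · simp only [singleOneRingHom_mul_single_one]
      exact existsUnique_sum_single e (fun _ => Equiv.refl S) r
    · simp only [single_one_mul_singleOneRingHom]
      exact existsUnique_sum_single e (fun j => MulAction.toPerm (e j)) r
  relativelyProjective := isRelativelyProjective_singleOneRingHom hG

end SkewGroupRing

/-! ### Transfer of precovers. -/

section Main

theorem IsExcellentExtension.gorensteinProjectivesArePrecovering {S R : Type u} [CommRing S]
    [Ring R] {i : S →+* R} (hi : IsExcellentExtension i)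
    (hS : GorensteinProjectivesArePrecovering S) : GorensteinProjectivesArePrecovering R := by
  obtain ⟨n, b, -, hl, hr⟩ := hi.exists_basis
  have := RightRestriction.free i hr
  have := inducedModuleFunctor_preservesFiniteLimits i
  have : Module.Free S ((ModuleCat.restrictScalars i).obj (ModuleCat.of R R)) :=
    .of_basis (restrictScalarsBasis hl)
  have := ModuleCat.restrictScalars_preservesProjectiveObjects (i := i)
  have := hi.coextendScalars_preservesProjectiveObjects
  have := (inducedModuleAdj i).rightAdjoint_preservesLimits
  refine IsPrecovering.of_adjunction (inducedModuleAdj i)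
    (fun M hM => hM.map_of_adjunction (inducedModuleAdj i))
    (fun N hN => hN.map_of_adjunction (ModuleCat.restrictCoextendScalarsAdj i)) (fun N => ?_) hS
  -- By the triangle identity, the unit at the restriction of `N` is an `S`-linear section of the
  -- counit.
  have : IsSplitEpi ((ModuleCat.restrictScalars i).map ((inducedModuleAdj i).counit.app N)) :=
    ⟨⟨⟨_, (inducedModuleAdj i).right_triangle_components N⟩⟩⟩
  exact hi.relativelyProjective.isSplitEpi _

end Main

theorem mainTheorem5 :
    (∀ (S R : Type u) [CommRing S] [Ring R] (i : S →+* R), IsExcellentExtension i →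
      GorensteinProjectivesArePrecovering S → GorensteinProjectivesArePrecovering R) ∧
    (∀ (S G : Type u) [Ring S] [Group G] [Finite G] [MulSemiringAction G S],
      IsUnit (Nat.card G : S) →
      IsExcellentExtension
        (SkewMonoidAlgebra.singleOneRingHom : S →+* SkewMonoidAlgebra S G)) ∧
    (∀ (S G : Type u) [CommRing S] [Group G] [Finite G] [MulSemiringAction G S],
      IsUnit (Nat.card G : S) →
      GorensteinProjectivesArePrecovering S →
      GorensteinProjectivesArePrecovering (SkewMonoidAlgebra S G)) := by
  exact ⟨fun _ _ _ _ _ hi hS => hi.gorensteinProjectivesArePrecovering hS,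
    fun _ _ _ _ _ _ hG => SkewMonoidAlgebra.isExcellentExtension_singleOneRingHom hG,
    fun _ _ _ _ _ _ hG hS =>
      (SkewMonoidAlgebra.isExcellentExtension_singleOneRingHom
        hG).gorensteinProjectivesArePrecovering hS⟩
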